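/- Let $\mathcal P(\mathbb R^d)$ be the set of Borel probability measures on $\mathbb R^d$, let $\pi^i$ and $\pi^{i,j}$ denote the projections of a finite product of copies of $\mathbb R^d$ onto the indicated components, and let $\#$ denote push-forward. For $\mu,\nu\in\mathcal P(\mathbb R^d)$ let $\Gamma(\mu,\nu)$ be the set of probability measures $\gamma$ on $\mathbb R^d\times\mathbb R^d$ with $\pi^1\#\gamma=\mu$ and $\pi^2\#\gamma=\nu$, let $$W_2(\mu,\nu)=\inf_{\gamma\in\Gamma(\mu,\nu)}\Big(\int|x_1-x_2|^2\,d\gamma(x_1,x_2)\Big)^{1/2}\in[0,\infty],$$ and let $\Gamma_0(\mu,\nu)$ be the set of $\gamma\in\Gamma(\mu,\nu)$ attaining this infimum. Fix $\omega_0\in\mathcal P(\mathbb R^d)$ and put $\mathcal P_{2,\omega_0}=\{\mu\in\mathcal P(\mathbb R^d): W_2(\mu,\omega_0)<\infty\}$. For $\mu_0,\mu_1,\omega\in\mathcal P_{2,\omega_0}$, a probability measure $\boldsymbol\omega$ on $\mathbb R^d\times\mathbb R^d\times\mathbb R^d$ is a transport plan from $\mu_0$ to $\mu_1$ with base $\omega$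 if $\pi^{1,2}\#\boldsymbol\omega\in\Gamma_0(\omega,\mu_0)$ and $\pi^{1,3}\#\boldsymbol\omega\in\Gamma_0(\omega,\mu_1)$. The generalized geodesic that it induces is $\mu_\alpha=((1-\alpha)\pi^2+\alpha\pi^3)\#\boldsymbol\omega$, $\alpha\in[0,1]$, and the corresponding pseudo-Wasserstein metric is $$W_{2,\boldsymbol\omega}(\mu_0,\mu_1)=\Big(\int|x_2-x_3|^2\,d\boldsymbol\omega(x_1,x_2,x_3)\Big)^{1/2}.$$ **Proposition.** Let $\mu_0,\mu_1,\omega\in\mathcal P_{2,\omega_0}$, let $\boldsymbol\omega$ be a transport plan from $\mu_0$ to $\mu_1$ with base $\omega$, and let $\mu_\alpha$ be the generalized geodesic induced by $\boldsymbol\omega$. Then $\mu_\alpha\in\mathcal P_{2,\omega_0}$ for all $\alpha\in[0,1]$, and for every $\nu\in\mathcal P_{2,\omega_0}$ there is a family $(\boldsymbol\omega_\alpha)_{\alpha\in[0,1]}$, where $\boldsymbol\omega_\alpha$ is a transport plan from $\nu$ to $\mu_\alpha$ with base $\omega$ (in particular, $\boldsymbol\omega_0$ and $\boldsymbol\omega_1$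 are transport plans from $\nu$ to $\mu_0$ and from $\nu$ to $\mu_1$ with base $\omega$), such that for all $\alpha\in[0,1]$ all the quantities below are finite and $$W_{2,\boldsymbol\omega_\alpha}^2(\nu,\mu_\alpha)=(1-\alpha)\,W_{2,\boldsymbol\omega_0}^2(\nu,\mu_0)+\alpha\,W_{2,\boldsymbol\omega_1}^2(\nu,\mu_1)-\alpha(1-\alpha)\,W_{2,\boldsymbol\omega}^2(\mu_0,\mu_1).$$ -/

import Mathlib

open MeasureTheory
open scoped ENNReal

noncomputable section

/-- `ℝ^d` with the Euclidean norm. -/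
abbrev Rd (d : ℕ) : Type := EuclideanSpace ℝ (Fin d)

/-- `Γ(μ, ν)`: the transport plans from `μ` to `ν`, i.e. the probability measures on `ℝ^d × ℝ^d`
with first marginal `μ` and second marginal `ν`. -/
def transportPlans {d : ℕ} (μ ν : Measure (Rd d)) : Set (Measure (Rd d × Rd d)) :=
  {γ | IsProbabilityMeasure γ ∧ γ.map (fun p => p.1) = μ ∧ γ.map (fun p => p.2) = ν}

/-- `(∫ |x₁ - x₂|² dγ)^(1/2)`, with values in `[0, ∞]`. -/
def quadraticCost {d : ℕ} (γ : Measure (Rd d × Rd d)) : ℝ≥0∞ :=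
  (∫⁻ p, ‖p.1 - p.2‖ₑ ^ 2 ∂γ) ^ (1 / 2 : ℝ)

/-- The Wasserstein distance `W₂(μ, ν)`, with values in `[0, ∞]`. -/
def W2 {d : ℕ} (μ ν : Measure (Rd d)) : ℝ≥0∞ :=
  ⨅ γ ∈ transportPlans μ ν, quadraticCost γ

/-- `Γ₀(μ, ν)`: the optimal transport plans from `μ` to `ν`. -/
def optimalPlans {d : ℕ} (μ ν : Measure (Rd d)) : Set (Measure (Rd d × Rd d)) :=
  {γ | γ ∈ transportPlans μ ν ∧ quadraticCost γ = W2 μ ν}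

/-- `P_{2,ω₀}(ℝ^d)`: the probability measures at finite Wasserstein distance from `ω₀`. -/
def P2 {d : ℕ} (ω₀ : Measure (Rd d)) : Set (Measure (Rd d)) :=
  {μ | IsProbabilityMeasure μ ∧ W2 μ ω₀ < ∞}

/-- `plan` is a transport plan from `μ₀` to `μ₁` with base `ω`: a probability measure on
`ℝ^d × ℝ^d × ℝ^d` whose `(1,2)`-marginal is in `Γ₀(ω, μ₀)` and whose `(1,3)`-marginal is in
`Γ₀(ω, μ₁)`. -/
def IsTransportPlanWithBase {d : ℕ} (ω μ₀ μ₁ : Measure (Rd d))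
    (plan : Measure (Rd d × Rd d × Rd d)) : Prop :=
  IsProbabilityMeasure plan ∧
    plan.map (fun p => (p.1, p.2.1)) ∈ optimalPlans ω μ₀ ∧
    plan.map (fun p => (p.1, p.2.2)) ∈ optimalPlans ω μ₁

/-- The generalized geodesic `μ_α = ((1 - α) π² + α π³) # plan` induced by `plan`. -/
def genGeodesic {d : ℕ} (plan : Measure (Rd d × Rd d × Rd d)) (α : ℝ) : Measure (Rd d) :=
  plan.map (fun p => (1 - α) • p.2.1 + α • p.2.2)

/-- The pseudo-Wasserstein metric `(∫ |x₂ - x₃|² dplan)^(1/2)`, with values in `[0, ∞]`. -/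
def pseudoW2 {d : ℕ} (plan : Measure (Rd d × Rd d × Rd d)) : ℝ≥0∞ :=
  (∫⁻ p, ‖p.2.1 - p.2.2‖ₑ ^ 2 ∂plan) ^ (1 / 2 : ℝ)

end

/-!
The squared distance satisfies, for `t ∈ [0, 1]`, the identity
`|x - ((1 - t) a + t b)|² + t (1 - t) |a - b|² = (1 - t) |x - a|² + t |x - b|²`.

The plan `plan` is glued along `ω` with an optimal plan from `ω` to `ν`. This gives the law of a
quadruple `(x, z, y₀, y₁)`, and the plan for the parameter `α` is the law of
`(x, z, (1 - α) y₀ + α y₁)`. Integrating the identity at the point `z` gives the claimed equality,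
so the only substantial point is that `(x, (1 - α) y₀ + α y₁)` is again an *optimal* coupling
(`map_interpolation_mem_optimalPlans`).

This needs neither cyclical monotonicity nor duality. Let `(x', y)` be any competitor. Gluing it
with `plan` along the interpolation gives a triple `(x', y₀, y₁)` with
`y = (1 - α) y₀ + α y₁`, in which `(y₀, y₁)` has the same law as before. Hence `(x', y₀)` and
`(x', y₁)` are couplings of the original marginals, whose costs are at least the optimal ones, and
the integrated identity shows that `(x', y)` costs at least as much as
`(x, (1 - α) y₀ + α y₁)`.

Optimal plans between measures exist because the set of couplings is tight and closed, hence
compact by Prokhorov's theorem, and the cost is lower semicontinuous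
(`exists_mem_optimalPlans`). Gluing rests on the disintegration of measures on standard Borel spaces
(`exists_gluing`).
-/

open Filter Topology ProbabilityTheory

/-! ### Gluing of measures -/

/-- Two measures on products with the same first marginal are the two-dimensional marginals of a
common measure: the second and third coordinates are taken conditionally independent given the
first. -/
lemma exists_gluing {A B C : Type*} [MeasurableSpace A] [MeasurableSpace B] [MeasurableSpace C]
    [StandardBorelSpace B] [Nonempty B] [StandardBorelSpace C] [Nonempty C]
    (ρ : Measure (A × B)) (σ : Measure (A × C)) [IsProbabilityMeasure ρ] [IsProbabilityMeasure σ]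
    (h : ρ.map (fun p => p.1) = σ.map (fun p => p.1)) :
    ∃ τ : Measure (A × B × C), IsProbabilityMeasure τ ∧
      τ.map (fun p => (p.1, p.2.1)) = ρ ∧ τ.map (fun p => (p.1, p.2.2)) = σ := by
  have h' : ρ.fst = σ.fst := h
  refine ⟨ρ.fst ⊗ₘ (ρ.condKernel ×ₖ σ.condKernel), inferInstance, ?_, ?_⟩
  · change Measure.map (Prod.map id Prod.fst) _ = ρ
    rw [← Measure.compProd_map measurable_fst, ← Kernel.fst_eq, Kernel.fst_prod,
      ρ.disintegrate ρ.condKernel]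
  · change Measure.map (Prod.map id Prod.snd) _ = σ
    rw [← Measure.compProd_map measurable_snd, ← Kernel.snd_eq, Kernel.snd_prod, h',
      σ.disintegrate σ.condKernel]

/-! ### The quadratic identity -/

lemma enorm_sq_eq_ofReal {E : Type*} [SeminormedAddCommGroup E] (v : E) :
    ‖v‖ₑ ^ 2 = ENNReal.ofReal (‖v‖ ^ 2) := by
  rw [← ofReal_norm, ENNReal.ofReal_pow (norm_nonneg v)]

lemma enorm_sub_interpolation_sq {E : Type*} [NormedAddCommGroup E] [InnerProductSpace ℝ E]
    (x a b : E) {t : ℝ} (ht : t ∈ Set.Icc (0 : ℝ) 1) :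
    ‖x - ((1 - t) • a + t • b)‖ₑ ^ 2 + ENNReal.ofReal (t * (1 - t)) * ‖a - b‖ₑ ^ 2 =
      ENNReal.ofReal (1 - t) * ‖x - a‖ₑ ^ 2 + ENNReal.ofReal t * ‖x - b‖ₑ ^ 2 := by
  have h0 : 0 ≤ t := ht.1
  have h1 : 0 ≤ 1 - t := sub_nonneg.2 ht.2
  have key : ‖x - ((1 - t) • a + t • b)‖ ^ 2 + t * (1 - t) * ‖a - b‖ ^ 2 =
      (1 - t) * ‖x - a‖ ^ 2 + t * ‖x - b‖ ^ 2 := by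
    have e1 : x - ((1 - t) • a + t • b) = (1 - t) • (x - a) + t • (x - b) := by module
    have e2 : a - b = (x - b) - (x - a) := by abel
    rw [e1, e2, norm_add_sq_real, norm_sub_sq_real, norm_smul, norm_smul, inner_smul_left,
      inner_smul_right, real_inner_comm (x - a) (x - b), mul_pow, mul_pow, Real.norm_eq_abs,
      Real.norm_eq_abs, sq_abs, sq_abs]
    simp only [conj_trivial]
    ring
  simp only [enorm_sq_eq_ofReal]
  rw [← ENNReal.ofReal_mul (by positivity), ← ENNReal.ofReal_mul h1, ← ENNReal.ofReal_mul h0,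
    ← ENNReal.ofReal_add (by positivity) (by positivity),
    ← ENNReal.ofReal_add (by positivity) (by positivity), key]

lemma enorm_sub_sq_le {E : Type*} [SeminormedAddCommGroup E] (x a b : E) :
    ‖a - b‖ₑ ^ 2 ≤ 2 * ‖x - a‖ₑ ^ 2 + 2 * ‖x - b‖ₑ ^ 2 := by
  have e : a - b = (x - b) - (x - a) := by abel
  have h : ‖a - b‖ ≤ ‖x - b‖ + ‖x - a‖ := by rw [e]; exact norm_sub_le _ _
  simp only [enorm_sq_eq_ofReal]
  rw [show (2 : ℝ≥0∞) = ENNReal.ofReal 2 by simp, ← ENNReal.ofReal_mul (by norm_num),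
    ← ENNReal.ofReal_mul (by norm_num), ← ENNReal.ofReal_add (by positivity) (by positivity)]
  apply ENNReal.ofReal_le_ofReal
  nlinarith [sq_nonneg (‖x - a‖ - ‖x - b‖), norm_nonneg (a - b)]

lemma lintegral_enorm_sub_interpolation_sq {Ω : Type*} [MeasurableSpace Ω] {d : ℕ} (τ : Measure Ω)
    {X Y Z : Ω → Rd d} (hX : Measurable X) (hY : Measurable Y) (hZ : Measurable Z)
    {t : ℝ} (ht : t ∈ Set.Icc (0 : ℝ) 1) :
    (∫⁻ p, ‖X p - ((1 - t) • Y p + t • Z p)‖ₑ ^ 2 ∂τ) +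
        ENNReal.ofReal (t * (1 - t)) * ∫⁻ p, ‖Y p - Z p‖ₑ ^ 2 ∂τ =
      ENNReal.ofReal (1 - t) * (∫⁻ p, ‖X p - Y p‖ₑ ^ 2 ∂τ) +
        ENNReal.ofReal t * ∫⁻ p, ‖X p - Z p‖ₑ ^ 2 ∂τ := by
  rw [← lintegral_const_mul _ (by fun_prop), ← lintegral_const_mul _ (by fun_prop),
    ← lintegral_const_mul _ (by fun_prop), ← lintegral_add_left (by fun_prop),
    ← lintegral_add_left (by fun_prop)]
  exact lintegral_congr fun p => enorm_sub_interpolation_sq _ _ _ ht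

lemma lintegral_enorm_sub_sq_lt_top {Ω : Type*} [MeasurableSpace Ω] {d : ℕ} {τ : Measure Ω}
    {X Y Z : Ω → Rd d} (hX : Measurable X) (hY : Measurable Y)
    (h₁ : ∫⁻ p, ‖X p - Y p‖ₑ ^ 2 ∂τ < ∞) (h₂ : ∫⁻ p, ‖X p - Z p‖ₑ ^ 2 ∂τ < ∞) :
    ∫⁻ p, ‖Y p - Z p‖ₑ ^ 2 ∂τ < ∞ := by
  refine (lintegral_mono fun p => enorm_sub_sq_le (X p) (Y p) (Z p)).trans_lt ?_
  rw [lintegral_add_left (by fun_prop), lintegral_const_mul' _ _ (by simp),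
    lintegral_const_mul' _ _ (by simp)]
  exact ENNReal.add_lt_top.2
    ⟨ENNReal.mul_lt_top (by simp) h₁, ENNReal.mul_lt_top (by simp) h₂⟩

/-! ### Quadratic cost and optimal plans -/

lemma rpow_half_lt_top_iff {a : ℝ≥0∞} : a ^ (1 / 2 : ℝ) < ∞ ↔ a < ∞ :=
  ENNReal.rpow_lt_top_iff_of_pos (by norm_num)

lemma toReal_rpow_half_sq (a : ℝ≥0∞) : (a ^ (1 / 2 : ℝ)).toReal ^ 2 = a.toReal := by
  rw [← ENNReal.toReal_pow, ← ENNReal.rpow_natCast, ← ENNReal.rpow_mul]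
  norm_num

lemma W2_lt_top_iff {d : ℕ} {μ ν : Measure (Rd d)} :
    W2 μ ν < ∞ ↔ ∃ γ ∈ transportPlans μ ν, ∫⁻ p, ‖p.1 - p.2‖ₑ ^ 2 ∂γ < ∞ := by
  simp only [W2, iInf_lt_iff, quadraticCost, rpow_half_lt_top_iff, exists_prop]

lemma mem_optimalPlans_iff {d : ℕ} {μ ν : Measure (Rd d)} {γ : Measure (Rd d × Rd d)} :
    γ ∈ optimalPlans μ ν ↔ γ ∈ transportPlans μ ν ∧ ∀ γ' ∈ transportPlans μ ν,
      ∫⁻ p, ‖p.1 - p.2‖ₑ ^ 2 ∂γ ≤ ∫⁻ p, ‖p.1 - p.2‖ₑ ^ 2 ∂γ' := by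
  have mono : ∀ a b : ℝ≥0∞, a ^ (1 / 2 : ℝ) ≤ b ^ (1 / 2 : ℝ) ↔ a ≤ b := fun a b =>
    ENNReal.rpow_le_rpow_iff (by norm_num)
  constructor
  · rintro ⟨h, h'⟩
    refine ⟨h, fun γ' hγ' => (mono _ _).1 ?_⟩
    exact h'.le.trans (iInf₂_le γ' hγ')
  · rintro ⟨h, h'⟩
    exact ⟨h, le_antisymm (le_iInf₂ fun γ' hγ' => (mono _ _).2 (h' γ' hγ')) (iInf₂_le γ h)⟩

lemma lintegral_lt_top_of_mem_optimalPlans {d : ℕ} {μ ν : Measure (Rd d)}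
    {γ : Measure (Rd d × Rd d)} (hγ : γ ∈ optimalPlans μ ν) (h : W2 μ ν < ∞) :
    ∫⁻ p, ‖p.1 - p.2‖ₑ ^ 2 ∂γ < ∞ :=
  rpow_half_lt_top_iff.1 (hγ.2.trans_lt h)

/-- The part of the triangle inequality used here: two measures at finite distance from a common one
are at finite distance from each other. -/
lemma W2_lt_top_of_common {d : ℕ} {μ ν₁ ν₂ : Measure (Rd d)} (h₁ : W2 μ ν₁ < ∞)
    (h₂ : W2 μ ν₂ < ∞) : W2 ν₁ ν₂ < ∞ := by
  obtain ⟨γ₁, ⟨hp₁, hf₁, hs₁⟩, hc₁⟩ := W2_lt_top_iff.1 h₁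
  obtain ⟨γ₂, ⟨hp₂, hf₂, hs₂⟩, hc₂⟩ := W2_lt_top_iff.1 h₂
  obtain ⟨τ, hτ, rfl, rfl⟩ := exists_gluing γ₁ γ₂ (hf₁.trans hf₂.symm)
  rw [lintegral_map (by fun_prop) (by fun_prop)] at hc₁ hc₂
  rw [Measure.map_map (by fun_prop) (by fun_prop)] at hs₁ hs₂
  refine W2_lt_top_iff.2 ⟨τ.map (fun p => p.2),
    ⟨Measure.isProbabilityMeasure_map (by fun_prop), ?_, ?_⟩, ?_⟩
  · rw [Measure.map_map (by fun_prop) (by fun_prop)]; exact hs₁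
  · rw [Measure.map_map (by fun_prop) (by fun_prop)]; exact hs₂
  · rw [lintegral_map (by fun_prop) (by fun_prop)]
    exact lintegral_enorm_sub_sq_lt_top measurable_fst (by fun_prop) hc₁ hc₂

lemma W2_lt_top_symm {d : ℕ} {μ ν : Measure (Rd d)} (h : W2 μ ν < ∞) : W2 ν μ < ∞ := by
  obtain ⟨γ, ⟨hp, hf, hs⟩, hc⟩ := W2_lt_top_iff.1 h
  refine W2_lt_top_iff.2 ⟨γ.map Prod.swap,
    ⟨Measure.isProbabilityMeasure_map (by fun_prop), ?_, ?_⟩, ?_⟩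
  · rw [Measure.map_map (by fun_prop) (by fun_prop)]; exact hs
  · rw [Measure.map_map (by fun_prop) (by fun_prop)]; exact hf
  · rw [lintegral_map (by fun_prop) (by fun_prop)]
    refine lt_of_eq_of_lt (lintegral_congr fun p => ?_) hc
    rw [Prod.fst_swap, Prod.snd_swap, enorm_sub_rev]

/-! ### Existence of optimal plans -/

/-- Weak convergence of plans does not increase the quadratic cost in the limit. -/
lemma lintegral_enorm_sub_sq_le_liminf {d : ℕ} {γs : ℕ → ProbabilityMeasure (Rd d × Rd d)}
    {γ : ProbabilityMeasure (Rd d × Rd d)} (h : Tendsto γs atTop (𝓝 γ)) :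
    ∫⁻ p, ‖p.1 - p.2‖ₑ ^ 2 ∂(γ : Measure (Rd d × Rd d)) ≤
      atTop.liminf fun n => ∫⁻ p, ‖p.1 - p.2‖ₑ ^ 2 ∂(γs n : Measure (Rd d × Rd d)) := by
  simp only [enorm_sq_eq_ofReal]
  exact lintegral_le_liminf_lintegral_of_forall_isOpen_measure_le_liminf_measure
    (f := fun p : Rd d × Rd d => ‖p.1 - p.2‖ ^ 2) (by fun_prop) (fun p => by positivity)
    fun G hG => ProbabilityMeasure.le_liminf_measure_open_of_tendsto h hG

lemma isCompact_transportPlans {d : ℕ} (μ ν : Measure (Rd d)) [IsProbabilityMeasure μ]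
    [IsProbabilityMeasure ν] :
    IsCompact {γ : ProbabilityMeasure (Rd d × Rd d) |
      (γ : Measure (Rd d × Rd d)) ∈ transportPlans μ ν} := by
  set S := {γ : ProbabilityMeasure (Rd d × Rd d) |
      (γ : Measure (Rd d × Rd d)) ∈ transportPlans μ ν}
  have hclosed : IsClosed S := by
    have e : S = {γ | γ.map (measurable_fst.aemeasurable) = ⟨μ, inferInstance⟩} ∩
        {γ | γ.map (measurable_snd.aemeasurable) = ⟨ν, inferInstance⟩} := by
      ext γ
      exact ⟨fun h => ⟨Subtype.ext h.2.1, Subtype.ext h.2.2⟩,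
        fun h => ⟨inferInstance, congrArg Subtype.val h.1, congrArg Subtype.val h.2⟩⟩
    rw [e]
    exact (isClosed_eq (ProbabilityMeasure.continuous_map continuous_fst) continuous_const).inter
      (isClosed_eq (ProbabilityMeasure.continuous_map continuous_snd) continuous_const)
  rw [← hclosed.closure_eq]
  refine isCompact_closure_of_isTightMeasureSet (IsTightMeasureSet.prodMk
    ((isTightMeasureSet_singleton (μ := μ)).subset ?_)
    ((isTightMeasureSet_singleton (μ := ν)).subset ?_))
  · rintro _ ⟨_, ⟨γ, hγ, rfl⟩, rfl⟩
    exact hγ.2.1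
  · rintro _ ⟨_, ⟨γ, hγ, rfl⟩, rfl⟩
    exact hγ.2.2

lemma exists_mem_optimalPlans {d : ℕ} (μ ν : Measure (Rd d)) [IsProbabilityMeasure μ]
    [IsProbabilityMeasure ν] : ∃ γ, γ ∈ optimalPlans μ ν := by
  set S := {γ : ProbabilityMeasure (Rd d × Rd d) |
      (γ : Measure (Rd d × Rd d)) ∈ transportPlans μ ν}
  let cost : ProbabilityMeasure (Rd d × Rd d) → ℝ≥0∞ :=
    fun γ => ∫⁻ p, ‖p.1 - p.2‖ₑ ^ 2 ∂(γ : Measure (Rd d × Rd d))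
  have hne : S.Nonempty :=
    ⟨⟨μ.prod ν, inferInstance⟩, (inferInstance : IsProbabilityMeasure (μ.prod ν)),
      Measure.fst_prod, Measure.snd_prod⟩
  obtain ⟨u, -, hu, huS⟩ := exists_seq_tendsto_sInf (hne.image cost) (OrderBot.bddBelow _)
  choose γs hγS hγu using huS
  obtain ⟨γ, hγ, φ, hφ, hlim⟩ := (isCompact_transportPlans μ ν).tendsto_subseq hγS
  refine ⟨γ, mem_optimalPlans_iff.2 ⟨hγ, fun γ' hγ' => ?_⟩⟩
  have hlim' : Tendsto (fun n => cost (γs (φ n))) atTop (𝓝 (sInf (cost '' S))) := by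
    simpa only [hγu, Function.comp_def] using hu.comp hφ.tendsto_atTop
  have hle : cost γ ≤ sInf (cost '' S) := by
    rw [← hlim'.liminf_eq]
    exact lintegral_enorm_sub_sq_le_liminf hlim
  have : IsProbabilityMeasure γ' := hγ'.1
  exact hle.trans (sInf_le ⟨⟨γ', hγ'.1⟩, hγ', rfl⟩)

/-! ### Optimality along generalized geodesics -/

/-- A plan and a competitor for its interpolated coupling, glued along the interpolation: the
result is a law of triples whose last two coordinates are distributed as those of the plan, and
whose first coordinate is coupled to the interpolation as prescribed. -/
lemma exists_plan_of_mem_transportPlans_genGeodesic {d : ℕ} {ω : Measure (Rd d)}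
    {plan : Measure (Rd d × Rd d × Rd d)} [IsProbabilityMeasure plan] {t : ℝ}
    {γ : Measure (Rd d × Rd d)} (hγ : γ ∈ transportPlans ω (genGeodesic plan t)) :
    ∃ τ : Measure (Rd d × Rd d × Rd d), IsProbabilityMeasure τ ∧ τ.map (fun p => p.1) = ω ∧
      τ.map (fun p => p.2) = plan.map (fun p => p.2) ∧
      τ.map (fun p => (p.1, (1 - t) • p.2.1 + t • p.2.2)) = γ := by
  obtain ⟨hp, hf, hs⟩ := hγ
  let I : Rd d × Rd d → Rd d := fun q => (1 - t) • q.1 + t • q.2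
  have hI : Measurable I := by fun_prop
  have hIp : Measurable fun p : Rd d × Rd d × Rd d => (I p.2, p.2) := by fun_prop
  have : IsProbabilityMeasure (γ.map Prod.swap) :=
    Measure.isProbabilityMeasure_map (by fun_prop)
  have : IsProbabilityMeasure (plan.map fun p => (I p.2, p.2)) :=
    Measure.isProbabilityMeasure_map hIp.aemeasurable
  obtain ⟨σ, hσ, h₁, h₂⟩ := exists_gluing (γ.map Prod.swap) (plan.map fun p => (I p.2, p.2)) (by
    rw [Measure.map_map (by fun_prop) (by fun_prop), Measure.map_map (by fun_prop) hIp]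
    exact hs)
  -- The first coordinate of `σ` is almost surely the interpolation of its last component.
  have hae : ∀ᵐ p ∂σ, p.1 = I p.2.2 := by
    have : ∀ᵐ q ∂(σ.map fun p => (p.1, p.2.2)), q.1 = I q.2 := by
      rw [h₂, ae_map_iff hIp.aemeasurable (measurableSet_eq_fun (by fun_prop) (by fun_prop))]
      exact Eventually.of_forall fun _ => rfl
    exact ae_of_ae_map (by fun_prop) this
  refine ⟨σ.map (fun p => p.2), Measure.isProbabilityMeasure_map (by fun_prop), ?_, ?_, ?_⟩
  · rw [Measure.map_map (by fun_prop) (by fun_prop), ← hf]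
    have := congrArg (Measure.map Prod.snd) h₁
    rw [Measure.map_map (by fun_prop) (by fun_prop),
      Measure.map_map (by fun_prop) (by fun_prop)] at this
    exact this
  · rw [Measure.map_map (by fun_prop) (by fun_prop)]
    have := congrArg (Measure.map Prod.snd) h₂
    rw [Measure.map_map (by fun_prop) (by fun_prop), Measure.map_map (by fun_prop) hIp] at this
    exact this
  · rw [Measure.map_map (by fun_prop) (by fun_prop)]
    have := congrArg (Measure.map Prod.swap) h₁
    rw [Measure.map_map (by fun_prop) (by fun_prop),
      Measure.map_map (by fun_prop) (by fun_prop), Prod.swap_swap_eq, Measure.map_id] at this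
    rw [← this]
    refine Measure.map_congr (hae.mono fun p hp => ?_)
    simp only [Function.comp_apply, Prod.swap_prod_mk, hp, I]

lemma map_interpolation_mem_transportPlans {d : ℕ} {ω : Measure (Rd d)}
    {plan : Measure (Rd d × Rd d × Rd d)} [IsProbabilityMeasure plan]
    (h : plan.map (fun p => p.1) = ω) (t : ℝ) :
    plan.map (fun p => (p.1, (1 - t) • p.2.1 + t • p.2.2)) ∈
      transportPlans ω (genGeodesic plan t) := by
  refine ⟨Measure.isProbabilityMeasure_map (by fun_prop), ?_, ?_⟩
  · rw [Measure.map_map (by fun_prop) (by fun_prop)]; exact h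
  · rw [Measure.map_map (by fun_prop) (by fun_prop)]; rfl

lemma IsTransportPlanWithBase.map_fst {d : ℕ} {ω μ₀ μ₁ : Measure (Rd d)}
    {plan : Measure (Rd d × Rd d × Rd d)} (h : IsTransportPlanWithBase ω μ₀ μ₁ plan) :
    plan.map (fun p => p.1) = ω := by
  rw [← h.2.1.1.2.1, Measure.map_map (by fun_prop) (by fun_prop)]
  rfl

lemma IsTransportPlanWithBase.lintegral_lt_top {d : ℕ} {ω μ₀ μ₁ : Measure (Rd d)}
    {plan : Measure (Rd d × Rd d × Rd d)} (h : IsTransportPlanWithBase ω μ₀ μ₁ plan)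
    (h₀ : W2 ω μ₀ < ∞) (h₁ : W2 ω μ₁ < ∞) :
    ∫⁻ p, ‖p.1 - p.2.1‖ₑ ^ 2 ∂plan < ∞ ∧ ∫⁻ p, ‖p.1 - p.2.2‖ₑ ^ 2 ∂plan < ∞ := by
  have c₀ := lintegral_lt_top_of_mem_optimalPlans h.2.1 h₀
  have c₁ := lintegral_lt_top_of_mem_optimalPlans h.2.2 h₁
  rw [lintegral_map (by fun_prop) (by fun_prop)] at c₀ c₁
  exact ⟨c₀, c₁⟩

lemma IsTransportPlanWithBase.pseudoW2_lt_top {d : ℕ} {ω μ₀ μ₁ : Measure (Rd d)}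
    {plan : Measure (Rd d × Rd d × Rd d)} (h : IsTransportPlanWithBase ω μ₀ μ₁ plan)
    (h₀ : W2 ω μ₀ < ∞) (h₁ : W2 ω μ₁ < ∞) : pseudoW2 plan < ∞ :=
  have c := h.lintegral_lt_top h₀ h₁
  rpow_half_lt_top_iff.2 <|
    lintegral_enorm_sub_sq_lt_top measurable_fst (by fun_prop) c.1 c.2

/-- Interpolating the two targets of a plan whose two couplings with the base are optimal gives an
optimal coupling of the base with the generalized geodesic. A competitor transfers, by gluing, to
competitors for the two given couplings that share the joint law of the targets. -/
lemma map_interpolation_mem_optimalPlans {d : ℕ} {ω μ₀ μ₁ : Measure (Rd d)}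
    {plan : Measure (Rd d × Rd d × Rd d)} (h : IsTransportPlanWithBase ω μ₀ μ₁ plan)
    (h₀ : W2 ω μ₀ < ∞) (h₁ : W2 ω μ₁ < ∞) {t : ℝ} (ht : t ∈ Set.Icc (0 : ℝ) 1) :
    plan.map (fun p => (p.1, (1 - t) • p.2.1 + t • p.2.2)) ∈
      optimalPlans ω (genGeodesic plan t) := by
  have : IsProbabilityMeasure plan := h.1
  refine mem_optimalPlans_iff.2 ⟨map_interpolation_mem_transportPlans h.map_fst t,
    fun γ hγ => ?_⟩
  obtain ⟨τ, hτ, hτ₁, hτ₂, rfl⟩ := exists_plan_of_mem_transportPlans_genGeodesic hγ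
  have law (f : Rd d × Rd d → Rd d) (hf : Measurable f) :
      τ.map (fun p => f p.2) = plan.map (fun p => f p.2) := by
    have := congrArg (Measure.map f) hτ₂
    rwa [Measure.map_map hf (by fun_prop), Measure.map_map hf (by fun_prop)] at this
  have competitor (f : Rd d × Rd d → Rd d) (hf : Measurable f) {μ : Measure (Rd d)}
      (hopt : plan.map (fun p => (p.1, f p.2)) ∈ optimalPlans ω μ) :
      ∫⁻ p, ‖p.1 - f p.2‖ₑ ^ 2 ∂plan ≤ ∫⁻ p, ‖p.1 - f p.2‖ₑ ^ 2 ∂τ := by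
    have hle := (mem_optimalPlans_iff.1 hopt).2 (τ.map fun p => (p.1, f p.2))
      ⟨Measure.isProbabilityMeasure_map (by fun_prop), by
        rw [Measure.map_map (by fun_prop) (by fun_prop)]; exact hτ₁, by
        rw [← hopt.1.2.2, Measure.map_map (by fun_prop) (by fun_prop),
          Measure.map_map (by fun_prop) (by fun_prop)]
        exact law f hf⟩
    rwa [lintegral_map (by fun_prop) (by fun_prop),
      lintegral_map (by fun_prop) (by fun_prop)] at hle
  have same : ∫⁻ p, ‖p.2.1 - p.2.2‖ₑ ^ 2 ∂τ = ∫⁻ p, ‖p.2.1 - p.2.2‖ₑ ^ 2 ∂plan := by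
    have hm : Measurable fun q : Rd d × Rd d => ‖q.1 - q.2‖ₑ ^ 2 := by fun_prop
    rw [← lintegral_map (f := fun q : Rd d × Rd d => ‖q.1 - q.2‖ₑ ^ 2) hm measurable_snd,
      ← lintegral_map (f := fun q : Rd d × Rd d => ‖q.1 - q.2‖ₑ ^ 2) hm measurable_snd]
    exact congrArg (fun m => ∫⁻ q, ‖q.1 - q.2‖ₑ ^ 2 ∂m) hτ₂
  have hfin : ∫⁻ p, ‖p.2.1 - p.2.2‖ₑ ^ 2 ∂plan < ∞ :=
    rpow_half_lt_top_iff.1 (h.pseudoW2_lt_top h₀ h₁)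
  rw [lintegral_map (by fun_prop) (by fun_prop), lintegral_map (by fun_prop) (by fun_prop)]
  -- The term subtracted in the quadratic identity is the same for both laws, and finite.
  refine (ENNReal.add_le_add_iff_right
    (ENNReal.mul_lt_top (ENNReal.ofReal_lt_top (r := t * (1 - t))) hfin).ne).1 ?_
  rw [lintegral_enorm_sub_interpolation_sq plan measurable_fst (by fun_prop) (by fun_prop) ht,
    ← same, lintegral_enorm_sub_interpolation_sq τ measurable_fst (by fun_prop) (by fun_prop) ht]
  exact add_le_add (mul_le_mul_right (competitor Prod.fst measurable_fst h.2.1) _)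
    (mul_le_mul_right (competitor Prod.snd measurable_snd h.2.2) _)

lemma W2_genGeodesic_lt_top {d : ℕ} {ω μ₀ μ₁ : Measure (Rd d)}
    {plan : Measure (Rd d × Rd d × Rd d)} (h : IsTransportPlanWithBase ω μ₀ μ₁ plan)
    (h₀ : W2 ω μ₀ < ∞) (h₁ : W2 ω μ₁ < ∞) {t : ℝ} (ht : t ∈ Set.Icc (0 : ℝ) 1) :
    W2 ω (genGeodesic plan t) < ∞ := by
  have : IsProbabilityMeasure plan := h.1
  refine W2_lt_top_iff.2 ⟨_, map_interpolation_mem_transportPlans h.map_fst t, ?_⟩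
  obtain ⟨c₀, c₁⟩ := h.lintegral_lt_top h₀ h₁
  rw [lintegral_map (by fun_prop) (by fun_prop)]
  refine le_self_add.trans_lt ((lintegral_enorm_sub_interpolation_sq plan measurable_fst
    (by fun_prop) (by fun_prop) ht).trans_lt ?_)
  exact ENNReal.add_lt_top.2
    ⟨ENNReal.mul_lt_top ENNReal.ofReal_lt_top c₀, ENNReal.mul_lt_top ENNReal.ofReal_lt_top c₁⟩

/-! ### The family of plans -/

theorem mainTheorem12 {d : ℕ} (ω₀ : Measure (Rd d)) (hω₀ : IsProbabilityMeasure ω₀)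
    (μ₀ μ₁ ω : Measure (Rd d)) (hμ₀ : μ₀ ∈ P2 ω₀) (hμ₁ : μ₁ ∈ P2 ω₀) (hω : ω ∈ P2 ω₀)
    (plan : Measure (Rd d × Rd d × Rd d)) (hplan : IsTransportPlanWithBase ω μ₀ μ₁ plan)
    (ν : Measure (Rd d)) (hν : ν ∈ P2 ω₀) :
    ∃ planα : ℝ → Measure (Rd d × Rd d × Rd d),
      IsTransportPlanWithBase ω ν μ₀ (planα 0) ∧
      IsTransportPlanWithBase ω ν μ₁ (planα 1) ∧
      pseudoW2 plan < ∞ ∧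
      ∀ α ∈ Set.Icc (0 : ℝ) 1,
        genGeodesic plan α ∈ P2 ω₀ ∧
        IsTransportPlanWithBase ω ν (genGeodesic plan α) (planα α) ∧
        pseudoW2 (planα α) < ∞ ∧
        (pseudoW2 (planα α)).toReal ^ 2 =
          (1 - α) * (pseudoW2 (planα 0)).toReal ^ 2 + α * (pseudoW2 (planα 1)).toReal ^ 2
            - α * (1 - α) * (pseudoW2 plan).toReal ^ 2 := by
  have : IsProbabilityMeasure plan := hplan.1
  have : IsProbabilityMeasure ω := hω.1
  have : IsProbabilityMeasure ν := hν.1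
  have finite_base {μ : Measure (Rd d)} (hμ : μ ∈ P2 ω₀) : W2 ω μ < ∞ :=
    W2_lt_top_of_common (W2_lt_top_symm hω.2) (W2_lt_top_symm hμ.2)
  have f₀ := finite_base hμ₀
  have f₁ := finite_base hμ₁
  have fν := finite_base hν
  obtain ⟨γ, hγ⟩ := exists_mem_optimalPlans ω ν
  have : IsProbabilityMeasure γ := hγ.1.1
  obtain ⟨σ, hσ, hσγ, hσplan⟩ := exists_gluing γ plan (hγ.1.2.1.trans hplan.map_fst.symm)
  let planα : ℝ → Measure (Rd d × Rd d × Rd d) := fun t =>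
    σ.map fun p => (p.1, p.2.1, (1 - t) • p.2.2.1 + t • p.2.2.2)
  have gen₀ : genGeodesic plan 0 = μ₀ := by
    rw [← hplan.2.1.1.2.2, Measure.map_map (by fun_prop) (by fun_prop)]
    simp [genGeodesic, Function.comp_def]
  have gen₁ : genGeodesic plan 1 = μ₁ := by
    rw [← hplan.2.2.1.2.2, Measure.map_map (by fun_prop) (by fun_prop)]
    simp [genGeodesic, Function.comp_def]
  have isPlan (t : ℝ) (ht : t ∈ Set.Icc (0 : ℝ) 1) :
      IsTransportPlanWithBase ω ν (genGeodesic plan t) (planα t) := by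
    refine ⟨Measure.isProbabilityMeasure_map (by fun_prop), ?_, ?_⟩
    · rw [Measure.map_map (by fun_prop) (by fun_prop)]
      exact (show σ.map (fun p => (p.1, p.2.1)) ∈ optimalPlans ω ν from hσγ ▸ hγ)
    · have e : (planα t).map (fun p => (p.1, p.2.2)) =
          plan.map (fun p => (p.1, (1 - t) • p.2.1 + t • p.2.2)) := by
        rw [← hσplan, Measure.map_map (by fun_prop) (by fun_prop),
          Measure.map_map (by fun_prop) (by fun_prop)]
        rfl
      exact e ▸ map_interpolation_mem_optimalPlans hplan f₀ f₁ ht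
  have fin (t : ℝ) (ht : t ∈ Set.Icc (0 : ℝ) 1) : pseudoW2 (planα t) < ∞ :=
    (isPlan t ht).pseudoW2_lt_top fν (W2_genGeodesic_lt_top hplan f₀ f₁ ht)
  have i₀ : (0 : ℝ) ∈ Set.Icc (0 : ℝ) 1 := by simp
  have i₁ : (1 : ℝ) ∈ Set.Icc (0 : ℝ) 1 := by simp
  have finPlan : pseudoW2 plan < ∞ := hplan.pseudoW2_lt_top f₀ f₁
  have cost (t : ℝ) : pseudoW2 (planα t) =
      (∫⁻ p, ‖p.2.1 - ((1 - t) • p.2.2.1 + t • p.2.2.2)‖ₑ ^ 2 ∂σ) ^ (1 / 2 : ℝ) := by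
    rw [pseudoW2, lintegral_map (by fun_prop) (by fun_prop)]
  have cost₀ : pseudoW2 (planα 0) = (∫⁻ p, ‖p.2.1 - p.2.2.1‖ₑ ^ 2 ∂σ) ^ (1 / 2 : ℝ) := by
    rw [cost]; simp
  have cost₁ : pseudoW2 (planα 1) = (∫⁻ p, ‖p.2.1 - p.2.2.2‖ₑ ^ 2 ∂σ) ^ (1 / 2 : ℝ) := by
    rw [cost]; simp
  have costPlan : pseudoW2 plan = (∫⁻ p, ‖p.2.2.1 - p.2.2.2‖ₑ ^ 2 ∂σ) ^ (1 / 2 : ℝ) := by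
    rw [← hσplan, pseudoW2, lintegral_map (by fun_prop) (by fun_prop)]
  refine ⟨planα, gen₀ ▸ isPlan 0 i₀, gen₁ ▸ isPlan 1 i₁, finPlan, fun t ht => ⟨⟨?_, ?_⟩,
    isPlan t ht, fin t ht, ?_⟩⟩
  · exact Measure.isProbabilityMeasure_map (by fun_prop)
  · exact W2_lt_top_of_common (W2_genGeodesic_lt_top hplan f₀ f₁ ht) hω.2
  · have k := fin t ht
    have k₀ := fin 0 i₀
    have k₁ := fin 1 i₁
    rw [cost, rpow_half_lt_top_iff] at k
    rw [cost₀, rpow_half_lt_top_iff] at k₀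
    rw [cost₁, rpow_half_lt_top_iff] at k₁
    rw [costPlan, rpow_half_lt_top_iff] at finPlan
    rw [cost₀, cost₁, costPlan, cost t]
    simp only [toReal_rpow_half_sq]
    have key := congrArg ENNReal.toReal (lintegral_enorm_sub_interpolation_sq σ
      (X := fun p => p.2.1) (Y := fun p => p.2.2.1) (Z := fun p => p.2.2.2)
      (by fun_prop) (by fun_prop) (by fun_prop) ht)
    rw [ENNReal.toReal_add k.ne (ENNReal.mul_ne_top ENNReal.ofReal_ne_top finPlan.ne),
      ENNReal.toReal_add (ENNReal.mul_ne_top ENNReal.ofReal_ne_top k₀.ne)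
        (ENNReal.mul_ne_top ENNReal.ofReal_ne_top k₁.ne), ENNReal.toReal_mul, ENNReal.toReal_mul,
      ENNReal.toReal_mul, ENNReal.toReal_ofReal (mul_nonneg ht.1 (sub_nonneg.2 ht.2)),
      ENNReal.toReal_ofReal (sub_nonneg.2 ht.2), ENNReal.toReal_ofReal ht.1] at key
    linarith
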